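/- Let $K$ be an algebraically closed field of characteristic zero and let $Z$ be a finite set of points in the projective plane $\mathbb{P}^2$ over $K$. For $P\in\mathbb{P}^2$ let $I(P)\subset K[x_0,x_1,x_2]$ be the homogeneous ideal of $P$, i.e. the ideal generated by the homogeneous polynomials vanishing at $P$. For an integer $m\ge 1$ let $I^{(m)}=\bigcap_{P\in Z} I(P)^m$ be the $m$-th symbolic power of the ideal $I=\bigcap_{P\in Z}I(P)$ of $Z$. For a non-zero homogeneous ideal $J$ let $\alpha(J)$ be the least degree of a non-zero homogeneous element of $J$, and for $m>n\ge 1$ put $\alpha_{m,n}(Z)=\alpha(I^{(m)})-\alpha(I^{(n)})$. If $k\ge 3$ is an integer such that $$\alpha_{k,k-1}(Z)=\alpha_{k-1,k-2}(Z)=1,$$ then the points of $Z$ are collinear, i.e. $Z$ is contained in a line. -/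

import Mathlib

open scoped LinearAlgebra.Projectivization

noncomputable section

namespace PlanarPoints

variable {K : Type*} [Field K]

/-- The homogeneous ideal `I(P)` of a point `P` of the projective plane: the ideal of
`K[x₀, x₁, x₂]` generated by the homogeneous polynomials vanishing at `P` (that is, on the line
through the origin of `K³` which is `P`). -/
def pointIdeal (P : ℙ K (Fin 3 → K)) : Ideal (MvPolynomial (Fin 3) K) :=
  Ideal.span {f | (∃ n : ℕ, f.IsHomogeneous n) ∧ ∀ v ∈ P.submodule, MvPolynomial.eval v f = 0}

/-- The `m`-th symbolic power `I(Z)^(m) = ⋂_{P ∈ Z} I(P)^m` of the ideal of a finite set `Z` of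
points in the projective plane. -/
def symbolicPower (Z : Finset (ℙ K (Fin 3 → K))) (m : ℕ) : Ideal (MvPolynomial (Fin 3) K) :=
  ⨅ P ∈ Z, pointIdeal P ^ m

/-- The initial degree of a homogeneous ideal `I`: the least `n` such that `I` contains a
non-zero form of degree `n`. (For `I = ⊥` there is no such `n` and the value is `0`; the ideals
`symbolicPower Z m` are never `⊥`.) -/
def initialDegree (I : Ideal (MvPolynomial (Fin 3) K)) : ℕ :=
  sInf {n : ℕ | ∃ f ∈ I, f.IsHomogeneous n ∧ f ≠ 0}

/-- The difference `α_{m,n}(Z) = α(I(Z)^(m)) - α(I(Z)^(n))`, as an integer. -/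
def alphaDiff (Z : Finset (ℙ K (Fin 3 → K))) (m n : ℕ) : ℤ :=
  (initialDegree (symbolicPower Z m) : ℤ) - (initialDegree (symbolicPower Z n) : ℤ)

end PlanarPoints

end

noncomputable section

namespace PlanarPoints

open MvPolynomial Module

section

variable {K : Type*} [Field K]

/-! ### Ideals of points -/

/-! Let `F` be a non-zero form of least degree `d` in the `k`-th symbolic power. The directions `v`
with `∂_v F = 0` form a subspace `vertex F`, which is proper because `F` has positive degree and the
characteristic is zero. It therefore suffices that every point of `Z` lies in it (`rep_mem_vertex`).

If every non-zero derivative of `F` divides `F`, then `vertex F` has codimension at most one, since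
`F` has finitely many divisors up to units while a pencil of derivatives is infinite
(`exists_smul_sub_mem_vertex`). A point of `Z` outside it would then force `F = 0`
(`eq_zero_of_dirDeriv_eq_zero`).

Otherwise some `∂_v F ≠ 0` does not divide `F`. Remove the common factor `G`: `F = G R`, `∂_v F = G
H`, with `deg H = t + 1`, `deg R = t + 2`. With `b_P = k - 1 - ord_P G` (truncated at `0`), Bezout's
inequality for `R` and `H` (`sum_mul_le_of_isRelPrime`) gives `∑ b_P (b_P + 1) ≤ (t + 1)(t + 2)`.
Minimality of the degrees for `k - 1` and `k - 2`, applied to multiples of `G`, gives by counting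
conditions (`le_sum_of_forall_eq_zero`) the reverse inequality and `t(t + 1) ≤ ∑ (b_P - 1) b_P`.
Together these leave a single point with `b_P ≠ 0`, and there `b_P = t + 1`
(`exists_eq_and_forall_eq_zero`). Differentiating `G` towards that point yields `d ≤ k`
(`degree_le_of_not_dirDeriv_dvd`). For each `P` in `Z`, the derivative of `F` towards `P` still has
multiplicity `k` at `P` but degree below `k`, so it vanishes. -/

lemma eval_smul_of_isHomogeneous {f : MvPolynomial (Fin 3) K} {n : ℕ} (hf : f.IsHomogeneous n)
    (c : K) (v : Fin 3 → K) : eval (c • v) f = c ^ n * eval v f := by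
  rw [eval_eq, eval_eq, Finset.mul_sum]
  refine Finset.sum_congr rfl fun d hd ↦ ?_
  rw [hf.degree_eq_sum_deg_support hd]
  simp only [Pi.smul_apply, smul_eq_mul, mul_pow, Finset.prod_mul_distrib,
    Finset.prod_pow_eq_pow_sum]
  ring

lemma mem_pointIdeal {P : ℙ K (Fin 3 → K)} {f : MvPolynomial (Fin 3) K} {n : ℕ}
    (hf : f.IsHomogeneous n) (h : eval P.rep f = 0) : f ∈ pointIdeal P := by
  refine Ideal.subset_span ⟨⟨n, hf⟩, fun v hv ↦ ?_⟩
  rw [P.submodule_eq, Submodule.mem_span_singleton] at hv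
  obtain ⟨c, rfl⟩ := hv
  rw [eval_smul_of_isHomogeneous hf, h, mul_zero]

lemma eval_eq_zero_of_mem_pointIdeal {P : ℙ K (Fin 3 → K)} {f : MvPolynomial (Fin 3) K}
    (hf : f ∈ pointIdeal P) {v : Fin 3 → K} (hv : v ∈ P.submodule) : eval v f = 0 := by
  have : pointIdeal P ≤ RingHom.ker (eval v) := Ideal.span_le.2 fun g hg ↦ hg.2 v hv
  exact this hf

lemma rep_mem_submodule (P : ℙ K (Fin 3 → K)) : P.rep ∈ P.submodule := by
  rw [P.submodule_eq]; exact Submodule.mem_span_singleton_self _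

/-- The linear form with given values on the standard basis. -/
def linForm (φ : (Fin 3 → K) →ₗ[K] K) : MvPolynomial (Fin 3) K :=
  ∑ i, C (φ (Pi.single i 1)) * X i

lemma linForm_isHomogeneous (φ : (Fin 3 → K) →ₗ[K] K) : (linForm φ).IsHomogeneous 1 :=
  IsHomogeneous.sum _ _ _ fun _ _ ↦ isHomogeneous_C_mul_X _ _

lemma eval_linForm (φ : (Fin 3 → K) →ₗ[K] K) (v : Fin 3 → K) : eval v (linForm φ) = φ v := by
  conv_rhs => rw [LinearMap.pi_apply_eq_sum_univ φ v]
  simp only [linForm, map_sum, map_mul, eval_C, eval_X, smul_eq_mul]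
  refine Finset.sum_congr rfl fun i _ ↦ ?_
  rw [mul_comm]
  congr 2
  ext j
  simp [Pi.single_apply, eq_comm]

lemma exists_linearForm_eval_eq_one {p : Fin 3 → K} (hp : p ≠ 0) :
    ∃ L : MvPolynomial (Fin 3) K, L.IsHomogeneous 1 ∧ eval p L = 1 := by
  obtain ⟨i, hi⟩ := Function.ne_iff.1 hp
  exact ⟨C (p i)⁻¹ * X i, isHomogeneous_C_mul_X _ _, by simpa using inv_mul_cancel₀ hi⟩

lemma exists_linearForm_separating {P Q : ℙ K (Fin 3 → K)} (h : P ≠ Q) :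
    ∃ L : MvPolynomial (Fin 3) K, L.IsHomogeneous 1 ∧ L ∈ pointIdeal Q ∧ eval P.rep L ≠ 0 := by
  have hP : P.rep ∉ Q.submodule := by
    intro hP
    rw [Q.submodule_eq, Submodule.mem_span_singleton] at hP
    obtain ⟨c, hc⟩ := hP
    apply h
    rw [← P.mk_rep, ← Q.mk_rep]
    exact (Projectivization.mk_eq_mk_iff' K _ _ _ _).2 ⟨c, hc⟩
  obtain ⟨φ, h1, h2⟩ := Submodule.exists_le_ker_of_notMem hP
  refine ⟨linForm φ, linForm_isHomogeneous φ, mem_pointIdeal (linForm_isHomogeneous φ) ?_, ?_⟩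
  · rw [eval_linForm]; exact h2 (rep_mem_submodule Q)
  · rwa [eval_linForm]

lemma exists_linearForm_mem_pointIdeal (P : ℙ K (Fin 3 → K)) :
    ∃ L : MvPolynomial (Fin 3) K, L.IsHomogeneous 1 ∧ L ∈ pointIdeal P ∧ L ≠ 0 := by
  obtain ⟨Q, hQ⟩ : ∃ Q : ℙ K (Fin 3 → K), Q ≠ P := by
    by_contra! h
    obtain ⟨c, hc⟩ := (Projectivization.mk_eq_mk_iff' K (Pi.single 0 1 : Fin 3 → K)
      (Pi.single 1 1) (by simp) (by simp)).1 ((h _).trans (h _).symm)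
    simpa using congrFun hc 0
  obtain ⟨L, h1, h2, h3⟩ := exists_linearForm_separating hQ
  exact ⟨L, h1, h2, fun h ↦ h3 (by simp [h])⟩

/-! ### The order of vanishing at a point -/

/-- The substitution `xᵢ ↦ pᵢ L + T (xᵢ - pᵢ L)`. -/
def deform (p : Fin 3 → K) (L : MvPolynomial (Fin 3) K) :
    MvPolynomial (Fin 3) K →ₐ[K] Polynomial (MvPolynomial (Fin 3) K) :=
  aeval fun i ↦ Polynomial.C (C (p i) * L) + Polynomial.X * Polynomial.C (X i - C (p i) * L)

lemma eval_deform (p : Fin 3 → K) (L r f : MvPolynomial (Fin 3) K) :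
    (deform p L f).eval r = aeval (fun i ↦ C (p i) * L + r * (X i - C (p i) * L)) f := by
  have h : ((Polynomial.aeval r).restrictScalars K).comp (deform p L) =
      aeval (fun i ↦ C (p i) * L + r * (X i - C (p i) * L)) := by
    ext i
    simp [deform]
  simpa [Polynomial.coe_aeval_eq_eval] using DFunLike.congr_fun h f

lemma eval_one_deform (p : Fin 3 → K) (L f : MvPolynomial (Fin 3) K) :
    (deform p L f).eval 1 = f := by
  simp [eval_deform]

lemma eval_zero_deform [Infinite K] {p : Fin 3 → K} {L f : MvPolynomial (Fin 3) K} {n : ℕ}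
    (hf : f.IsHomogeneous n) : (deform p L f).eval 0 = L ^ n * C (eval p f) := by
  rw [eval_deform]
  refine MvPolynomial.funext fun v ↦ ?_
  have h : eval v (aeval (fun i ↦ C (p i) * L + 0 * (X i - C (p i) * L)) f) =
      eval (eval v L • p) f := by
    rw [← coe_aeval_eq_eval, RingHom.coe_coe, ← AlgHom.comp_apply, comp_aeval,
      ← coe_aeval_eq_eval, RingHom.coe_coe]
    congr 2
    ext i
    simp [mul_comm]
  rw [h, eval_smul_of_isHomogeneous hf]
  simp

/-- Each `xᵢ - pᵢ L` vanishes at `P`, so every factor `T` comes with an element of `I(P)`: the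
coefficient of `T ^ i` lies in `I(P) ^ i`. -/
lemma deform_mem_reesAlgebra {P : ℙ K (Fin 3 → K)} {L : MvPolynomial (Fin 3) K}
    (hL : L.IsHomogeneous 1) (hLP : eval P.rep L = 1) (f : MvPolynomial (Fin 3) K) :
    deform P.rep L f ∈ reesAlgebra (pointIdeal P) := by
  have hX (i : Fin 3) : deform P.rep L (X i) ∈ reesAlgebra (pointIdeal P) := by
    have h1 : X i - C (P.rep i) * L ∈ pointIdeal P :=
      mem_pointIdeal ((isHomogeneous_X _ _).sub (hL.C_mul _)) (by simp [hLP])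
    have h2 : Polynomial.X * Polynomial.C (X i - C (P.rep i) * L) =
        Polynomial.monomial 1 (X i - C (P.rep i) * L) := by
      rw [mul_comm, Polynomial.C_mul_X_eq_monomial]
    rw [deform, aeval_X, h2]
    exact add_mem (Subalgebra.algebraMap_mem _ _)
      (reesAlgebra.monomial_mem.2 (by simpa using h1))
  induction f using MvPolynomial.induction_on with
  | C a =>
    rw [← algebraMap_eq, AlgHom.commutes, IsScalarTower.algebraMap_apply K
      (MvPolynomial (Fin 3) K) (Polynomial (MvPolynomial (Fin 3) K))]
    exact Subalgebra.algebraMap_mem _ _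
  | add f g hf hg => rw [map_add]; exact add_mem hf hg
  | mul_X f i hf => rw [map_mul]; exact mul_mem hf (hX i)

section Infinite

variable [Infinite K]

/-- This turns the order of vanishing at `P` into a `T`-adic valuation. At `T = 0` the deformation
of a form becomes its value at `P` times a power of `L`, and at `T = 1` it returns `f` as the sum of
its coefficients. -/
lemma mem_pointIdeal_pow_iff {P : ℙ K (Fin 3 → K)} {L : MvPolynomial (Fin 3) K}
    (hL : L.IsHomogeneous 1) (hLP : eval P.rep L = 1) {f : MvPolynomial (Fin 3) K} {m : ℕ} :
    f ∈ pointIdeal P ^ m ↔ Polynomial.X ^ m ∣ deform P.rep L f := by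
  constructor
  · intro hf
    have h1 : pointIdeal P ≤ (Ideal.span {Polynomial.X}).comap (deform P.rep L).toRingHom := by
      refine Ideal.span_le.2 ?_
      rintro g ⟨⟨n, hn⟩, hg⟩
      change deform P.rep L g ∈ Ideal.span {Polynomial.X}
      rw [Ideal.mem_span_singleton, Polynomial.X_dvd_iff, Polynomial.coeff_zero_eq_eval_zero,
        eval_zero_deform hn, hg _ (rep_mem_submodule P)]
      simp
    have h2 := Ideal.le_comap_pow _ m (Ideal.pow_right_mono h1 m hf)
    rw [Ideal.span_singleton_pow, Ideal.mem_comap, Ideal.mem_span_singleton] at h2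
    exact h2
  · intro h
    rw [Polynomial.X_pow_dvd_iff] at h
    rw [← eval_one_deform P.rep L f, Polynomial.eval_eq_sum_range]
    refine Ideal.sum_mem _ fun i _ ↦ ?_
    rw [one_pow, mul_one]
    rcases lt_or_ge i m with hi | hi
    · rw [h i hi]; exact zero_mem _
    · exact Ideal.pow_le_pow_right hi (deform_mem_reesAlgebra hL hLP f i)

/-- Orders of vanishing are additive, because `T` is prime in the polynomial ring receiving the
deformation. -/
lemma mem_pow_of_mul_mem {P : ℙ K (Fin 3 → K)} {f g : MvPolynomial (Fin 3) K} {m c : ℕ}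
    (h : g * f ∈ pointIdeal P ^ m) (hg : g ∉ pointIdeal P ^ (c + 1)) :
    f ∈ pointIdeal P ^ (m - c) := by
  obtain ⟨L, hL, hLP⟩ := exists_linearForm_eval_eq_one P.rep_nonzero
  rw [mem_pointIdeal_pow_iff hL hLP] at h hg ⊢
  rw [map_mul] at h
  have hX : Prime (Polynomial.X : Polynomial (MvPolynomial (Fin 3) K)) := Polynomial.prime_X
  rcases Nat.le_total m c with hmc | hmc
  · simp [Nat.sub_eq_zero_of_le hmc]
  have h0 : ¬ Polynomial.X ^ (c + 1) ∣ deform P.rep L g := hg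
  obtain ⟨g', hg', hdvd⟩ := (FiniteMultiplicity.def.2 ⟨c, h0⟩).exists_eq_pow_mul_and_not_dvd
  set a := multiplicity Polynomial.X (deform P.rep L g)
  have ha : a ≤ c := by
    by_contra! ha
    exact h0 ((pow_dvd_pow _ ha).trans ⟨g', hg'⟩)
  rw [hg', mul_assoc, ← Nat.add_sub_of_le (ha.trans hmc), pow_add] at h
  have h1 := (mul_dvd_mul_iff_left (pow_ne_zero a hX.ne_zero)).1 h
  exact (pow_dvd_pow _ (by omega)).trans (hX.pow_dvd_of_dvd_mul_left _ hdvd h1)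

end Infinite

lemma notMem_of_eval_ne_zero {P : ℙ K (Fin 3 → K)} {f : MvPolynomial (Fin 3) K}
    (h : eval P.rep f ≠ 0) : f ∉ pointIdeal P ^ (0 + 1) := by
  rw [zero_add, pow_one]
  exact fun hf ↦ h (eval_eq_zero_of_mem_pointIdeal hf (rep_mem_submodule P))

/-! ### Directional derivatives -/

/-- The derivative in the direction of the vector `v`. -/
def dirDeriv (v : Fin 3 → K) : Derivation K (MvPolynomial (Fin 3) K) (MvPolynomial (Fin 3) K) :=
  ∑ i, v i • pderiv i

lemma dirDeriv_apply (v : Fin 3 → K) (f : MvPolynomial (Fin 3) K) :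
    dirDeriv v f = ∑ i, v i • pderiv i f := by
  simp only [dirDeriv, ← Derivation.coeFnAddMonoidHom_apply, map_sum, Finset.sum_apply]
  rfl

lemma dirDeriv_single (i : Fin 3) (f : MvPolynomial (Fin 3) K) :
    dirDeriv (Pi.single i 1) f = pderiv i f := by
  simp [dirDeriv_apply, Pi.single_apply]

lemma dirDeriv_add (v w : Fin 3 → K) (f : MvPolynomial (Fin 3) K) :
    dirDeriv (v + w) f = dirDeriv v f + dirDeriv w f := by
  simp [dirDeriv_apply, add_smul, Finset.sum_add_distrib]

lemma dirDeriv_smul (c : K) (v : Fin 3 → K) (f : MvPolynomial (Fin 3) K) :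
    dirDeriv (c • v) f = c • dirDeriv v f := by
  simp [dirDeriv_apply, mul_smul, Finset.smul_sum]

lemma dirDeriv_isHomogeneous {f : MvPolynomial (Fin 3) K} {n : ℕ} (hf : f.IsHomogeneous n)
    (v : Fin 3 → K) : (dirDeriv v f).IsHomogeneous (n - 1) := by
  rw [dirDeriv_apply]
  refine IsHomogeneous.sum _ _ _ fun i _ ↦ ?_
  rw [smul_eq_C_mul]
  exact hf.pderiv.C_mul _

lemma dirDeriv_comm (v w : Fin 3 → K) (f : MvPolynomial (Fin 3) K) :
    dirDeriv v (dirDeriv w f) = dirDeriv w (dirDeriv v f) := by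
  have h : ⁅dirDeriv v, dirDeriv w⁆ = 0 := by
    ext i
    simp [Derivation.commutator_apply, dirDeriv_apply, pderiv_X, Pi.single_apply]
  simpa [Derivation.commutator_apply, sub_eq_zero] using DFunLike.congr_fun h f

lemma sum_X_mul_dirDeriv {f : MvPolynomial (Fin 3) K} {n : ℕ} (hf : f.IsHomogeneous n) :
    ∑ i, X i * dirDeriv (Pi.single i 1) f = n • f := by
  simpa only [dirDeriv_single] using hf.sum_X_mul_pderiv

lemma eval_dirDeriv_self {f : MvPolynomial (Fin 3) K} {n : ℕ} (hf : f.IsHomogeneous n)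
    (v : Fin 3 → K) : eval v (dirDeriv v f) = n * eval v f := by
  have := congrArg (eval v) hf.sum_X_mul_pderiv
  simpa [dirDeriv_apply, smul_eval] using this

lemma derivation_mem_pow {R A : Type*} [CommRing R] [CommRing A] [Algebra R A]
    (D : Derivation R A A) (I : Ideal A) (m : ℕ) {f : A} (hf : f ∈ I ^ (m + 1)) :
    D f ∈ I ^ m := by
  induction m generalizing f with
  | zero => simp
  | succ m ih =>
    rw [pow_succ'] at hf
    refine Submodule.mul_induction_on hf (fun a ha b hb ↦ ?_) fun x y hx hy ↦ ?_
    · rw [D.leibniz, smul_eq_mul, smul_eq_mul]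
      refine add_mem ?_ (Ideal.mul_mem_right _ _ hb)
      rw [pow_succ']
      exact Ideal.mul_mem_mul ha (ih hb)
    · rw [map_add]; exact add_mem hx hy

lemma derivation_mem_pow_of_le {R A : Type*} [CommRing R] [CommRing A] [Algebra R A]
    (D : Derivation R A A) {I : Ideal A} (hD : ∀ f ∈ I, D f ∈ I) (m : ℕ) {f : A}
    (hf : f ∈ I ^ m) : D f ∈ I ^ m := by
  induction m generalizing f with
  | zero => simp
  | succ m ih =>
    rw [pow_succ'] at hf ⊢
    refine Submodule.mul_induction_on hf (fun a ha b hb ↦ ?_) fun x y hx hy ↦ ?_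
    · rw [D.leibniz, smul_eq_mul, smul_eq_mul, mul_comm b]
      exact add_mem (Ideal.mul_mem_mul ha (ih hb)) (Ideal.mul_mem_mul (hD a ha) hb)
    · rw [map_add]; exact add_mem hx hy

/-- A derivative usually costs one order of vanishing, but not in the direction of the point itself:
by Euler's relation `∂_p` preserves vanishing at `p`. -/
lemma dirDeriv_rep_mem_pow {P : ℙ K (Fin 3 → K)} {f : MvPolynomial (Fin 3) K} {m : ℕ}
    (hf : f ∈ pointIdeal P ^ m) : dirDeriv P.rep f ∈ pointIdeal P ^ m := by
  refine derivation_mem_pow_of_le _ (fun g hg ↦ ?_) m hf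
  refine Submodule.span_induction ?_ ?_ ?_ ?_ hg
  · rintro x ⟨⟨n, hn⟩, hx⟩
    exact mem_pointIdeal (dirDeriv_isHomogeneous hn _)
      (by rw [eval_dirDeriv_self hn, hx _ (rep_mem_submodule P), mul_zero])
  · simp
  · intro x y _ _ hx hy; rw [map_add]; exact add_mem hx hy
  · intro a x hx hDx
    rw [smul_eq_mul, (dirDeriv P.rep).leibniz, smul_eq_mul, smul_eq_mul]
    exact add_mem (Ideal.mul_mem_left _ _ hDx) (Ideal.mul_mem_right _ _ hx)

variable [CharZero K]

lemma eq_zero_of_forall_dirDeriv {f : MvPolynomial (Fin 3) K} {n : ℕ} (hf : f.IsHomogeneous n)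
    (hn : n ≠ 0) (h : ∀ v, dirDeriv v f = 0) : f = 0 := by
  have := sum_X_mul_dirDeriv hf
  simpa [h, hn] using this.symm

lemma eq_zero_of_mem_pow {P : ℙ K (Fin 3 → K)} {f : MvPolynomial (Fin 3) K} {n m : ℕ}
    (hf : f.IsHomogeneous n) (hm : f ∈ pointIdeal P ^ m) (h : n < m) : f = 0 := by
  induction n generalizing f m with
  | zero =>
    obtain ⟨c, rfl⟩ : ∃ c, f = C c := ⟨_, (totalDegree_eq_zero_iff_eq_C.1
      ((totalDegree_zero_iff_isHomogeneous _).2 hf))⟩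
    have := eval_eq_zero_of_mem_pointIdeal (Ideal.pow_le_self (by omega) hm) (rep_mem_submodule P)
    simpa using this
  | succ n ih =>
    obtain ⟨m, rfl⟩ : ∃ m', m = m' + 1 := ⟨m - 1, by omega⟩
    exact eq_zero_of_forall_dirDeriv hf (by omega) fun v ↦
      ih (dirDeriv_isHomogeneous hf v) (derivation_mem_pow _ _ _ hm) (by omega)

/-- Such a form is a cone with vertex `P`, a polynomial in linear forms vanishing at `P`. -/
lemma mem_pow_of_dirDeriv_rep_eq_zero {P : ℙ K (Fin 3 → K)} {f : MvPolynomial (Fin 3) K} {n : ℕ}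
    (hf : f.IsHomogeneous n) (h : dirDeriv P.rep f = 0) : f ∈ pointIdeal P ^ n := by
  induction n generalizing f with
  | zero => simp
  | succ n ih =>
    obtain ⟨L, hL, hLP⟩ := exists_linearForm_eval_eq_one P.rep_nonzero
    have h1 : ((n + 1 : ℕ) : K) • f =
        ∑ i, (X i - C (P.rep i) * L) * dirDeriv (Pi.single i 1) f := by
      have h2 : ∑ i, C (P.rep i) * dirDeriv (Pi.single i 1) f = 0 := by
        simpa only [dirDeriv_single, smul_eq_C_mul, dirDeriv_apply P.rep] using h
      calc _ = ∑ i, X i * dirDeriv (Pi.single i 1) f := by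
            rw [sum_X_mul_dirDeriv hf, Nat.cast_smul_eq_nsmul]
        -- Subtracting `L * ∂_p f = 0` from Euler's relation replaces each `xᵢ` by `xᵢ - pᵢ L`,
        -- which lies in `I(P)`.
        _ = ∑ i, X i * dirDeriv (Pi.single i 1) f -
            L * ∑ i, C (P.rep i) * dirDeriv (Pi.single i 1) f := by rw [h2]; ring
        _ = _ := by
            rw [Finset.mul_sum, ← Finset.sum_sub_distrib]
            exact Finset.sum_congr rfl fun i _ ↦ by ring
    have h3 : ((n + 1 : ℕ) : K) • f ∈ pointIdeal P ^ (n + 1) := by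
      rw [h1, pow_succ']
      refine Ideal.sum_mem _ fun i _ ↦ Ideal.mul_mem_mul
        (mem_pointIdeal ((isHomogeneous_X _ _).sub (hL.C_mul _)) (by simp [hLP])) ?_
      exact ih (dirDeriv_isHomogeneous hf _) (by rw [dirDeriv_comm, h, map_zero])
    have h4 : f = C ((n + 1 : ℕ) : K)⁻¹ * (((n + 1 : ℕ) : K) • f) := by
      rw [← smul_eq_C_mul, smul_smul, inv_mul_cancel₀ (Nat.cast_ne_zero.2 n.succ_ne_zero), one_smul]
    rw [h4]
    exact Ideal.mul_mem_left _ _ h3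

/-- A form which is killed by all derivatives along `N`, and vanishes at a vector which together
with `N` spans the whole space, is zero. -/
lemma eq_zero_of_dirDeriv_eq_zero {f : MvPolynomial (Fin 3) K} {n : ℕ} (hf : f.IsHomogeneous n)
    {N : Submodule K (Fin 3 → K)} (hN : ∀ v ∈ N, dirDeriv v f = 0) {p : Fin 3 → K}
    (hp : eval p f = 0) (hNp : N ⊔ Submodule.span K {p} = ⊤) : f = 0 := by
  induction n generalizing f with
  | zero =>
    obtain ⟨c, rfl⟩ : ∃ c, f = C c := ⟨_, (totalDegree_eq_zero_iff_eq_C.1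
      ((totalDegree_zero_iff_isHomogeneous _).2 hf))⟩
    simpa using hp
  | succ n ih =>
    -- The derivative along `p` satisfies the same hypotheses in degree one less, its vanishing at
    -- `p` being Euler's relation.
    have h0 : dirDeriv p f = 0 := ih (dirDeriv_isHomogeneous hf p)
      (fun v hv ↦ by rw [dirDeriv_comm, hN v hv, map_zero])
      (by rw [eval_dirDeriv_self hf, hp, mul_zero])
    refine eq_zero_of_forall_dirDeriv hf n.succ_ne_zero fun v ↦ ?_
    have hv : v ∈ N ⊔ Submodule.span K {p} := by rw [hNp]; trivial
    obtain ⟨y, hy, z, hz, rfl⟩ := Submodule.mem_sup.1 hv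
    obtain ⟨c, rfl⟩ := Submodule.mem_span_singleton.1 hz
    rw [dirDeriv_add, dirDeriv_smul, hN y hy, h0, smul_zero, add_zero]

end

section

variable {K : Type*} [Field K]

/-! ### Divisors of forms -/

section Divisors

variable {σ : Type*}

/-- The substitution `xᵢ ↦ T xᵢ`. -/
def gradeMap (σ K : Type*) [Field K] : MvPolynomial σ K →ₐ[K] Polynomial (MvPolynomial σ K) :=
  aeval fun i ↦ Polynomial.X * Polynomial.C (X i)

lemma gradeMap_monomial (d : σ →₀ ℕ) (c : K) :
    gradeMap σ K (monomial d c) = Polynomial.monomial d.degree (monomial d c) := by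
  rw [gradeMap, aeval_monomial, ← Polynomial.C_mul_X_pow_eq_monomial, monomial_eq,
    IsScalarTower.algebraMap_apply K (MvPolynomial σ K) (Polynomial (MvPolynomial σ K))]
  simp only [Finsupp.prod, mul_pow, Finset.prod_mul_distrib, Finset.prod_pow_eq_pow_sum,
    Polynomial.C_mul, map_prod, Polynomial.C_pow, Finsupp.degree_apply]
  simp [algebraMap_eq]
  ring

lemma coeff_gradeMap (f : MvPolynomial σ K) (n : ℕ) :
    (gradeMap σ K f).coeff n = homogeneousComponent n f := by
  classical
  induction f using MvPolynomial.induction_on' with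
  | monomial d c =>
    rw [gradeMap_monomial, Polynomial.coeff_monomial]
    split_ifs with h
    · rw [homogeneousComponent_of_mem (isHomogeneous_monomial c h), if_pos rfl]
    · rw [homogeneousComponent_of_mem (isHomogeneous_monomial c rfl), if_neg (Ne.symm h)]
  | add f g hf hg => simp [hf, hg]

lemma gradeMap_of_isHomogeneous {f : MvPolynomial σ K} {n : ℕ} (hf : f.IsHomogeneous n) :
    gradeMap σ K f = Polynomial.monomial n f := by
  ext1 i
  rw [coeff_gradeMap, homogeneousComponent_of_mem hf, Polynomial.coeff_monomial]
  simp [eq_comm]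

lemma isHomogeneous_of_gradeMap {f : MvPolynomial σ K} (hf : f ≠ 0)
    (h : (gradeMap σ K f).natTrailingDegree = (gradeMap σ K f).natDegree) :
    f.IsHomogeneous (gradeMap σ K f).natDegree := by
  set n := (gradeMap σ K f).natDegree
  have h1 (i : ℕ) (hi : i ≠ n) : homogeneousComponent i f = 0 := by
    rw [← coeff_gradeMap]
    rcases lt_or_gt_of_ne hi with hi | hi
    · exact Polynomial.coeff_eq_zero_of_lt_natTrailingDegree (h ▸ hi)
    · exact Polynomial.coeff_eq_zero_of_natDegree_lt hi
  have h2 := sum_homogeneousComponent f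
  by_cases hn : n ∈ Finset.range (f.totalDegree + 1)
  · rw [Finset.sum_eq_single_of_mem n hn fun i _ hi ↦ h1 i hi] at h2
    rw [← h2]
    exact homogeneousComponent_isHomogeneous n f
  · rw [Finset.sum_eq_zero fun i hi ↦ h1 i fun h ↦ hn (h ▸ hi)] at h2
    exact absurd h2.symm hf

/-- The factors of a non-zero form are forms. -/
lemma exists_isHomogeneous_of_mul {f g : MvPolynomial σ K} {n : ℕ}
    (h : (f * g).IsHomogeneous n) (h0 : f * g ≠ 0) :
    ∃ a b, f.IsHomogeneous a ∧ g.IsHomogeneous b ∧ a + b = n := by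
  have hf : f ≠ 0 := left_ne_zero_of_mul h0
  have hg : g ≠ 0 := right_ne_zero_of_mul h0
  have hinj {q : MvPolynomial σ K} (hq : q ≠ 0) : gradeMap σ K q ≠ 0 := by
    intro h
    apply hq
    rw [← sum_homogeneousComponent q]
    exact Finset.sum_eq_zero fun i _ ↦ by rw [← coeff_gradeMap, h, Polynomial.coeff_zero]
  have hm := gradeMap_of_isHomogeneous h
  rw [map_mul] at hm
  -- Degree and trailing degree in `T` are both additive. They agree on the product, a monomial in
  -- `T`, hence on each factor.
  have h1 := congrArg Polynomial.natDegree hm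
  have h2 := congrArg Polynomial.natTrailingDegree hm
  rw [Polynomial.natDegree_mul (hinj hf) (hinj hg), Polynomial.natDegree_monomial_eq _ h0] at h1
  rw [Polynomial.natTrailingDegree_mul (hinj hf) (hinj hg),
    Polynomial.natTrailingDegree_monomial h0] at h2
  have h3 := Polynomial.natTrailingDegree_le_natDegree (gradeMap σ K f)
  have h4 := Polynomial.natTrailingDegree_le_natDegree (gradeMap σ K g)
  exact ⟨_, _, isHomogeneous_of_gradeMap hf (by omega), isHomogeneous_of_gradeMap hg (by omega), h1⟩

end Divisors

/-! ### Jets at a point -/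

/-- The exponents `(a, s - a)` of the monomials in two variables of degree `s < m`. -/
abbrev JetIndex (m : ℕ) : Type := Σ s : Fin m, Fin (s.1 + 1)

lemma two_mul_card_jetIndex (m : ℕ) : 2 * Fintype.card (JetIndex m) = m * (m + 1) := by
  rw [Fintype.card_sigma]
  simp only [Fintype.card_fin]
  rw [Fin.sum_univ_eq_sum_range (fun i ↦ i + 1)]
  induction m with
  | zero => rfl
  | succ m ih => rw [Finset.sum_range_succ, mul_add, ih]; ring

/-- The exponent `(a, s - a, n - s)`. -/
def jetExponent (n : ℕ) {m : ℕ} (i : JetIndex m) : Fin 3 →₀ ℕ :=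
  Finsupp.equivFunOnFinite.symm ![i.2, i.1 - i.2, n - i.1]

lemma degree_fin_three (d : Fin 3 →₀ ℕ) : d.degree = d 0 + d 1 + d 2 := by
  rw [Finsupp.degree_eq_sum, Fin.sum_univ_three]

lemma jetExponent_injective (n m : ℕ) :
    Function.Injective (jetExponent n : JetIndex m → Fin 3 →₀ ℕ) := by
  rintro ⟨⟨s, hs⟩, ⟨a, ha⟩⟩ ⟨⟨t, ht⟩, ⟨b, hb⟩⟩ h
  have h0 : a = b := DFunLike.congr_fun h 0
  have h1 : s - a = t - b := DFunLike.congr_fun h 1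
  dsimp only at ha hb
  obtain rfl : s = t := by omega
  subst h0
  rfl

lemma degree_jetExponent {n m : ℕ} (h : m ≤ n + 1) (i : JetIndex m) :
    (jetExponent n i).degree = n := by
  obtain ⟨⟨s, hs⟩, ⟨a, ha⟩⟩ := i
  rw [degree_fin_three]
  change a + (s - a) + (n - s) = n
  dsimp only at ha
  omega

/-- The space of forms of degree `n` in three variables. -/
abbrev Forms (K : Type*) [Field K] (n : ℕ) : Submodule K (MvPolynomial (Fin 3) K) :=
  homogeneousSubmodule (Fin 3) K n

/-- The jet of order `m` at `(0 : 0 : 1)` of forms of degree `n`. -/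
def stdJet (K : Type*) [Field K] (n m : ℕ) : Forms K n →ₗ[K] (JetIndex m → K) :=
  (LinearMap.pi fun i ↦ lcoeff K (jetExponent n i)).domRestrict _

lemma stdJet_apply {n m : ℕ} (f : Forms K n) (i : JetIndex m) :
    stdJet K n m f i = coeff (jetExponent n i) f.1 := rfl

lemma stdJet_surjective {n m : ℕ} (h : m ≤ n + 1) : Function.Surjective (stdJet K n m) := by
  classical
  intro u
  refine ⟨⟨∑ i, monomial (jetExponent n i) (u i), ?_⟩, ?_⟩
  · exact Submodule.sum_mem _ fun i _ ↦ isHomogeneous_monomial _ (degree_jetExponent h i)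
  · ext j
    rw [stdJet_apply]
    simp [coeff_sum, coeff_monomial, (jetExponent_injective n m).eq_iff]

lemma stdJet_eq_zero_iff {n m : ℕ} (f : Forms K n) :
    stdJet K n m f = 0 ↔ ∀ d : Fin 3 →₀ ℕ, d 0 + d 1 < m → coeff d f.1 = 0 := by
  constructor
  · intro h d hd
    by_cases hn : d.degree = n
    · have := congrFun h ⟨⟨d 0 + d 1, hd⟩, ⟨d 0, by simp⟩⟩
      rw [stdJet_apply] at this
      rw [Pi.zero_apply] at this
      convert this using 2
      rw [degree_fin_three] at hn
      ext j
      fin_cases j <;> simp [jetExponent]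
      omega
    · exact f.2.coeff_eq_zero hn
  · intro h
    ext i
    rw [stdJet_apply]
    refine h _ ?_
    obtain ⟨⟨s, hs⟩, ⟨a, ha⟩⟩ := i
    change a + (s - a) < m
    dsimp only at ha
    omega

lemma stdJet_injective (n : ℕ) : Function.Injective (stdJet K n (n + 1)) := by
  rw [injective_iff_map_eq_zero]
  intro f hf
  rw [stdJet_eq_zero_iff] at hf
  ext d
  by_cases hn : d.degree = n
  · rw [degree_fin_three] at hn
    simpa using hf d (by omega)
  · simpa using f.2.coeff_eq_zero hn

instance (n : ℕ) : FiniteDimensional K (Forms K n) :=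
  FiniteDimensional.of_injective (stdJet K n (n + 1)) (stdJet_injective n)

lemma two_mul_finrank_forms (n : ℕ) : 2 * finrank K (Forms K n) = (n + 1) * (n + 2) := by
  rw [(LinearEquiv.ofBijective (stdJet K n (n + 1))
    ⟨stdJet_injective n, stdJet_surjective le_rfl⟩).finrank_eq, finrank_fintype_fun_eq_card,
    two_mul_card_jetIndex]

/-- This is the ideal of `(0 : 0 : 1)`. Its powers are monomial ideals, so membership can be read
off the coefficients. -/
lemma mem_span_X_pow_iff {f : MvPolynomial (Fin 3) K} {m : ℕ} :
    f ∈ Ideal.span {X 0, X 1} ^ m ↔ ∀ d : Fin 3 →₀ ℕ, d 0 + d 1 < m → coeff d f = 0 := by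
  classical
  constructor
  · intro hf
    induction m generalizing f with
    | zero => intro d hd; omega
    | succ m ih =>
      rw [pow_succ'] at hf
      refine Submodule.mul_induction_on hf (fun a ha b hb ↦ ?_) fun x y hx hy d hd ↦ ?_
      · intro d hd
        rw [coeff_mul]
        refine Finset.sum_eq_zero fun e he ↦ ?_
        rw [Finset.HasAntidiagonal.mem_antidiagonal] at he
        by_cases h0 : e.1 0 + e.1 1 = 0
        · have h1 : X '' {0, 1} = ({X 0, X 1} : Set (MvPolynomial (Fin 3) K)) := by
            simp [Set.image_pair]
          rw [← h1, mem_ideal_span_X_image] at ha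
          have : coeff e.1 a = 0 := by
            by_contra hne
            obtain ⟨i, hi, hi'⟩ := ha e.1 (mem_support_iff.2 hne)
            rcases hi with rfl | rfl <;> omega
          rw [this, zero_mul]
        · have h2 := DFunLike.congr_fun he 0
          have h3 := DFunLike.congr_fun he 1
          rw [Finsupp.add_apply] at h2 h3
          rw [ih hb e.2 (by omega), mul_zero]
      · rw [coeff_add, hx d hd, hy d hd, add_zero]
  · intro h
    rw [f.as_sum]
    refine Ideal.sum_mem _ fun d hd ↦ ?_
    have hm : m ≤ d 0 + d 1 := by
      by_contra! hm
      exact mem_support_iff.1 hd (h d hm)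
    refine Ideal.pow_le_pow_right hm ?_
    rw [monomial_eq, Finsupp.prod_fintype _ _ (by simp), Fin.prod_univ_three, pow_add]
    refine Ideal.mul_mem_left _ _ (Ideal.mul_mem_right _ _ (Ideal.mul_mem_mul ?_ ?_)) <;>
    exact Ideal.pow_mem_pow (Ideal.subset_span (by simp)) _

/-! ### Linear changes of coordinates -/

/-- The substitution of a linear map into polynomials. -/
def subst (e : (Fin 3 → K) →ₗ[K] (Fin 3 → K)) : MvPolynomial (Fin 3) K →ₐ[K] MvPolynomial (Fin 3) K :=
  aeval fun i ↦ linForm (LinearMap.proj i ∘ₗ e)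

lemma eval_subst (e : (Fin 3 → K) →ₗ[K] (Fin 3 → K)) (f : MvPolynomial (Fin 3) K)
    (v : Fin 3 → K) : eval v (subst e f) = eval (e v) f := by
  rw [← coe_aeval_eq_eval, RingHom.coe_coe, subst, ← AlgHom.comp_apply, comp_aeval,
    ← coe_aeval_eq_eval, RingHom.coe_coe]
  congr 2
  ext i
  simp [eval_linForm, aeval_eq_eval]

lemma subst_isHomogeneous (e : (Fin 3 → K) →ₗ[K] (Fin 3 → K)) {f : MvPolynomial (Fin 3) K} {n : ℕ}
    (hf : f.IsHomogeneous n) : (subst e f).IsHomogeneous n := by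
  have := hf.aeval (fun i ↦ linForm (LinearMap.proj i ∘ₗ e)) (n := 1)
    fun i ↦ linForm_isHomogeneous _
  simpa [subst] using this

lemma exists_linearEquiv_submodule_eq_span (P : ℙ K (Fin 3 → K)) :
    ∃ e : (Fin 3 → K) ≃ₗ[K] (Fin 3 → K), P.submodule = Submodule.span K {e (Pi.single 2 1)} := by
  have h0 : (Pi.single 2 1 : Fin 3 → K) ≠ 0 := by simp
  have : MulAction.IsPretransitive ((Fin 3 → K) ≃ₗ[K] (Fin 3 → K)) (ℙ K (Fin 3 → K)) :=
    MulAction.isPretransitive_of_is_two_pretransitive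
  obtain ⟨e, he⟩ := MulAction.exists_smul_eq ((Fin 3 → K) ≃ₗ[K] (Fin 3 → K))
    (Projectivization.mk K (Pi.single 2 1 : Fin 3 → K) h0) P
  refine ⟨e, ?_⟩
  rw [← he, Projectivization.smul_mk, Projectivization.submodule_mk]
  rfl

section

variable [Infinite K]

/-- A linear change of coordinates moves `P` to `(0 : 0 : 1)`, where the jet is a list of
coefficients. The bound `m ≤ n + 1` ensures that all the listed monomials really have degree `n`. -/
lemma exists_jet (P : ℙ K (Fin 3 → K)) (n m : ℕ) :
    ∃ J : Forms K n →ₗ[K] (JetIndex m → K), (∀ f, J f = 0 ↔ f.1 ∈ pointIdeal P ^ m) ∧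
      (m ≤ n + 1 → Function.Surjective J) := by
  obtain ⟨e, he⟩ := exists_linearEquiv_submodule_eq_span P
  have hinv (f : MvPolynomial (Fin 3) K) : subst e.symm.toLinearMap (subst e.toLinearMap f) = f :=
    MvPolynomial.funext fun v ↦ by simp [eval_subst]
  have hinv' (f : MvPolynomial (Fin 3) K) : subst e.toLinearMap (subst e.symm.toLinearMap f) = f :=
    MvPolynomial.funext fun v ↦ by simp [eval_subst]
  have h1 : pointIdeal P ≤ (Ideal.span {X 0, X 1}).comap (subst e.toLinearMap).toRingHom := by
    refine Ideal.span_le.2 ?_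
    rintro f ⟨⟨k, hk⟩, hf⟩
    change subst e.toLinearMap f ∈ Ideal.span {X 0, X 1}
    rw [← pow_one (Ideal.span _), mem_span_X_pow_iff]
    intro d hd
    have hk' {c : Fin 3 →₀ ℕ} (hc : c ∈ (subst e.toLinearMap f).support) : c.degree = k := by
      by_contra h
      exact mem_support_iff.1 hc ((subst_isHomogeneous _ hk).coeff_eq_zero h)
    by_cases hdk : d.degree = k
    · have h2 : eval (Pi.single 2 1) (subst e.toLinearMap f) = 0 := by
        rw [eval_subst]
        exact hf _ (he ▸ Submodule.mem_span_singleton_self _)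
      rw [degree_fin_three] at hdk
      rw [eval_eq', Finset.sum_eq_single d] at h2
      · simpa [Fin.prod_univ_three, show d 0 = 0 by omega, show d 1 = 0 by omega] using h2
      · intro c hc hcd
        have hck := hk' hc
        rw [degree_fin_three] at hck
        have h01 : c 0 ≠ 0 ∨ c 1 ≠ 0 := by
          by_contra! h01
          refine hcd (Finsupp.ext fun i ↦ ?_)
          fin_cases i <;> simp <;> omega
        rcases h01 with h01 | h01 <;> simp [Fin.prod_univ_three, h01]
      · intro hd'
        rw [notMem_support_iff.1 hd', zero_mul]
    · exact (subst_isHomogeneous _ hk).coeff_eq_zero hdk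
  have h2 : Ideal.span {X 0, X 1} ≤ (pointIdeal P).comap (subst e.symm.toLinearMap).toRingHom := by
    refine Ideal.span_le.2 ?_
    have hX (i : Fin 3) (hi : i ≠ 2) : subst e.symm.toLinearMap (X i) ∈ pointIdeal P := by
      refine Ideal.subset_span ⟨⟨1, subst_isHomogeneous _ (isHomogeneous_X _ _)⟩, fun v hv ↦ ?_⟩
      rw [he, Submodule.mem_span_singleton] at hv
      obtain ⟨c, rfl⟩ := hv
      simp [eval_subst, hi]
    rintro f (rfl | rfl)
    · exact hX 0 (by decide)
    · exact hX 1 (by decide)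
  have h3 (f : MvPolynomial (Fin 3) K) :
      subst e.toLinearMap f ∈ Ideal.span {X 0, X 1} ^ m ↔ f ∈ pointIdeal P ^ m := by
    constructor
    · intro h
      have := Ideal.le_comap_pow _ m (Ideal.pow_right_mono h2 m h)
      rw [Ideal.mem_comap] at this
      simpa [hinv] using this
    · intro h
      exact Ideal.le_comap_pow _ m (Ideal.pow_right_mono h1 m h)
  let T : Forms K n →ₗ[K] Forms K n := (subst e.toLinearMap).toLinearMap.restrict
    fun f hf ↦ subst_isHomogeneous _ hf
  refine ⟨stdJet K n m ∘ₗ T, fun f ↦ ?_, fun hm ↦ ?_⟩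
  · rw [LinearMap.comp_apply, stdJet_eq_zero_iff, ← mem_span_X_pow_iff]
    exact h3 f.1
  · rw [LinearMap.coe_comp]
    refine (stdJet_surjective hm).comp fun g ↦ ⟨⟨subst e.symm.toLinearMap g.1,
      subst_isHomogeneous _ g.2⟩, Subtype.ext (hinv' g.1)⟩

end

end

section

variable {K : Type*} [Field K]

/-! ### Curves with assigned multiplicities -/

section Multijet

variable [Infinite K]

/-- A linear map from the forms of degree `n` with kernel the forms of multiplicity `m` at `P`. -/
def jet (P : ℙ K (Fin 3 → K)) (n m : ℕ) : Forms K n →ₗ[K] (JetIndex m → K) :=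
  (exists_jet P n m).choose

lemma jet_eq_zero_iff {P : ℙ K (Fin 3 → K)} {n m : ℕ} {f : Forms K n} :
    jet P n m f = 0 ↔ f.1 ∈ pointIdeal P ^ m :=
  (exists_jet P n m).choose_spec.1 f

lemma jet_surjective (P : ℙ K (Fin 3 → K)) {n m : ℕ} (h : m ≤ n + 1) :
    Function.Surjective (jet P n m) :=
  (exists_jet P n m).choose_spec.2 h

/-- The jets of orders `m P` at the points `P` of `Z`. -/
def multijet (Z : Finset (ℙ K (Fin 3 → K))) (n : ℕ) (m : ℙ K (Fin 3 → K) → ℕ) :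
    Forms K n →ₗ[K] (Π P : Z, JetIndex (m P) → K) :=
  LinearMap.pi fun P ↦ jet P.1 n (m P)

lemma multijet_eq_zero_iff {Z : Finset (ℙ K (Fin 3 → K))} {n : ℕ} {m : ℙ K (Fin 3 → K) → ℕ}
    {f : Forms K n} : multijet Z n m f = 0 ↔ ∀ P ∈ Z, f.1 ∈ pointIdeal P ^ m P := by
  simp only [multijet, funext_iff, LinearMap.pi_apply, Pi.zero_apply, ← jet_eq_zero_iff]
  exact ⟨fun h P hP ↦ h ⟨P, hP⟩, fun h P ↦ h P.1 P.2⟩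

omit [Infinite K] in
lemma two_mul_finrank_multijet (Z : Finset (ℙ K (Fin 3 → K))) (m : ℙ K (Fin 3 → K) → ℕ) :
    2 * finrank K (Π P : Z, JetIndex (m P) → K) = ∑ P ∈ Z, m P * (m P + 1) := by
  rw [finrank_pi_fintype, Finset.mul_sum]
  simp only [finrank_fintype_fun_eq_card, two_mul_card_jetIndex]
  exact Finset.sum_coe_sort Z fun P ↦ m P * (m P + 1)

/-- If no non-zero form of degree `n` has multiplicities at least `m P` at the points of `Z`, then
the conditions imposed are at least as many as the coefficients of the form. -/
lemma le_sum_of_forall_eq_zero {Z : Finset (ℙ K (Fin 3 → K))} {n : ℕ}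
    {m : ℙ K (Fin 3 → K) → ℕ} (h : ∀ f : MvPolynomial (Fin 3) K, f.IsHomogeneous n →
      (∀ P ∈ Z, f ∈ pointIdeal P ^ m P) → f = 0) :
    (n + 1) * (n + 2) ≤ ∑ P ∈ Z, m P * (m P + 1) := by
  rw [← two_mul_finrank_forms (K := K), ← two_mul_finrank_multijet]
  refine Nat.mul_le_mul_left _ (LinearMap.finrank_le_finrank_of_injective
    (f := multijet Z n m) ?_)
  rw [injective_iff_map_eq_zero]
  exact fun f hf ↦ Subtype.ext (h f.1 f.2 (multijet_eq_zero_iff.1 hf))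

/-- Multiplication by a form. -/
def mulForm {F : MvPolynomial (Fin 3) K} {r a b : ℕ} (hF : F.IsHomogeneous r) (h : r + a = b) :
    Forms K a →ₗ[K] Forms K b :=
  (LinearMap.mulLeft K F).restrict fun f hf ↦ by
    subst h; exact hF.mul (show f.IsHomogeneous a from hf)

omit [Infinite K] in
lemma coe_mulForm {F : MvPolynomial (Fin 3) K} {r a b : ℕ} (hF : F.IsHomogeneous r)
    (h : r + a = b) (f : Forms K a) : (mulForm hF h f).1 = F * f.1 := rfl

-- Take a product of lines through the points of `Z` that avoid `P`. Multiplying by it isolates `P`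
-- when jets are prescribed at several points.
omit [Infinite K] in
lemma exists_form_separating (Z : Finset (ℙ K (Fin 3 → K))) (m : ℙ K (Fin 3 → K) → ℕ)
    {P : ℙ K (Fin 3 → K)} (hP : P ∉ Z) :
    ∃ E : MvPolynomial (Fin 3) K, E.IsHomogeneous (∑ Q ∈ Z, m Q) ∧ eval P.rep E ≠ 0 ∧
      ∀ Q ∈ Z, E ∈ pointIdeal Q ^ m Q := by
  have hL (Q : ℙ K (Fin 3 → K)) : ∃ L : MvPolynomial (Fin 3) K, Q ∈ Z →
      L.IsHomogeneous 1 ∧ L ∈ pointIdeal Q ∧ eval P.rep L ≠ 0 := by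
    by_cases hQ : Q ∈ Z
    · obtain ⟨L, hL⟩ := exists_linearForm_separating (P := P) (Q := Q) fun h ↦ hP (h ▸ hQ)
      exact ⟨L, fun _ ↦ hL⟩
    · exact ⟨0, fun h ↦ absurd h hQ⟩
  choose L hL using hL
  refine ⟨∏ Q ∈ Z, L Q ^ m Q, IsHomogeneous.prod _ _ _ fun Q hQ ↦ ?_, ?_, fun Q hQ ↦ ?_⟩
  · simpa using (hL Q hQ).1.pow (m Q)
  · rw [map_prod, Finset.prod_ne_zero_iff]
    intro Q hQ
    rw [map_pow]
    exact pow_ne_zero _ (hL Q hQ).2.2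
  · classical
    rw [← Finset.mul_prod_erase Z _ hQ]
    exact Ideal.mul_mem_right _ _ (Ideal.pow_mem_pow (hL Q hQ).2.1 _)

omit [Infinite K] in
lemma finrank_range_le_of_ker_le {V W W' : Type*} [AddCommGroup V] [Module K V]
    [FiniteDimensional K V] [AddCommGroup W] [Module K W] [AddCommGroup W'] [Module K W']
    {f : V →ₗ[K] W} {g : V →ₗ[K] W'} (h : LinearMap.ker g ≤ LinearMap.ker f) :
    finrank K (LinearMap.range f) ≤ finrank K (LinearMap.range g) := by
  have h1 := f.finrank_range_add_finrank_ker
  have h2 := g.finrank_range_add_finrank_ker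
  have h3 := Submodule.finrank_mono h
  omega

omit [Infinite K] in
lemma finrank_range_le_add_finrank_ker {V W U : Type*} [AddCommGroup V] [Module K V]
    [AddCommGroup W] [Module K W] [FiniteDimensional K W] [AddCommGroup U] [Module K U]
    (T : V →ₗ[K] W) (J : W →ₗ[K] U) :
    finrank K (LinearMap.range T) ≤
      finrank K (LinearMap.range (J ∘ₗ T)) + finrank K (LinearMap.ker J) := by
  have h1 := (J ∘ₗ (LinearMap.range T).subtype).finrank_range_add_finrank_ker
  rw [LinearMap.range_comp, Submodule.range_subtype, ← LinearMap.range_comp] at h1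
  have h2 : finrank K (LinearMap.ker (J ∘ₗ (LinearMap.range T).subtype)) ≤
      finrank K (LinearMap.ker J) := by
    rw [← Submodule.finrank_map_subtype_eq]
    refine Submodule.finrank_mono ?_
    rintro _ ⟨x, hx, rfl⟩
    exact hx
  omega

lemma multijet_surjective (Z : Finset (ℙ K (Fin 3 → K))) {n : ℕ} {m : ℙ K (Fin 3 → K) → ℕ}
    (hn : ∑ P ∈ Z, m P ≤ n) : Function.Surjective (multijet Z n m) := by
  classical
  have key (P : Z) (u : JetIndex (m P) → K) : ∃ f : Forms K n, jet P.1 n (m P) f = u ∧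
      ∀ Q ∈ Z, Q ≠ P → f.1 ∈ pointIdeal Q ^ m Q := by
    obtain ⟨E, hE, hEP, hEQ⟩ := exists_form_separating (Z.erase P.1) m (P := P.1) (by simp)
    have hsum := Finset.add_sum_erase Z m P.2
    set e := ∑ Q ∈ Z.erase P.1, m Q
    have hen : e + (n - e) = n := by omega
    have hker : LinearMap.ker (jet P.1 n (m P) ∘ₗ mulForm hE hen) =
        LinearMap.ker (jet P.1 (n - e) (m P)) := by
      ext f
      rw [LinearMap.mem_ker, LinearMap.mem_ker, LinearMap.comp_apply, jet_eq_zero_iff,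
        jet_eq_zero_iff, coe_mulForm]
      exact ⟨fun h ↦ mem_pow_of_mul_mem h (notMem_of_eval_ne_zero hEP),
        fun h ↦ Ideal.mul_mem_left _ _ h⟩
    -- Since `E` does not vanish at `P`, multiplication by it does not change the kernel of the jet.
    -- The rank is then that of the jet in degree `n - e`, which is full because `m P ≤ n - e`.
    have hsurj : LinearMap.range (jet P.1 n (m P) ∘ₗ mulForm hE hen) = ⊤ := by
      apply Submodule.eq_top_of_finrank_eq
      apply le_antisymm (Submodule.finrank_le _)
      rw [← finrank_top K (JetIndex (m P) → K),
        ← LinearMap.range_eq_top.2 (jet_surjective P.1 (n := n - e) (m := m P) (by omega))]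
      exact finrank_range_le_of_ker_le hker.le
    obtain ⟨f, hf⟩ := LinearMap.range_eq_top.1 hsurj u
    exact ⟨mulForm hE hen f, hf, fun Q hQ hQP ↦
      Ideal.mul_mem_right _ _ (hEQ Q (Finset.mem_erase.2 ⟨hQP, hQ⟩))⟩
  intro u
  choose f hf hf' using fun P : Z ↦ key P (u P)
  refine ⟨∑ P, f P, ?_⟩
  ext1 Q
  change jet Q.1 n (m Q) (∑ P, f P) = u Q
  rw [map_sum, Finset.sum_eq_single Q, hf]
  · intro P _ hPQ
    exact jet_eq_zero_iff.2 (hf' P Q.1 Q.2 fun h ↦ hPQ (Subtype.ext h.symm))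
  · intro h; exact absurd (Finset.mem_univ _) h

-- For coprime `F` and `H` the only syzygies are the Koszul ones, the multiples `c (H, -F)`; `c` is
-- a form because factors of forms are forms.
omit [Infinite K] in
lemma finrank_ker_syzygy_le {F H : MvPolynomial (Fin 3) K} {r s : ℕ} (hF : F.IsHomogeneous r)
    (hH : H.IsHomogeneous s) (hH0 : H ≠ 0) (hrel : IsRelPrime F H) (q : ℕ) :
    finrank K (LinearMap.ker ((mulForm hF rfl).coprod (mulForm hH (by ring)) :
      Forms K (s + q) × Forms K (r + q) →ₗ[K] Forms K (r + (s + q)))) ≤ finrank K (Forms K q) := by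
  refine le_trans (Submodule.finrank_mono (t := LinearMap.range
    ((mulForm hH rfl).prod (-mulForm hF rfl) :
      Forms K q →ₗ[K] Forms K (s + q) × Forms K (r + q))) ?_) (LinearMap.finrank_range_le _)
  rintro ⟨u, w⟩ huw
  have h1 : F * u.1 + H * w.1 = 0 := congrArg Subtype.val huw
  have h2 : H ∣ u.1 := by
    refine hrel.symm.dvd_of_dvd_mul_left (z := u.1) ⟨-w.1, ?_⟩
    linear_combination h1
  obtain ⟨c, hc⟩ := h2
  have hw : w.1 = -(F * c) := by
    apply mul_left_cancel₀ hH0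
    rw [hc] at h1
    linear_combination h1
  have hcq : c.IsHomogeneous q := by
    by_cases hc0 : c = 0
    · rw [hc0]; exact isHomogeneous_zero _ _ _
    have hne : H * c ≠ 0 := mul_ne_zero hH0 hc0
    have hu : (H * c).IsHomogeneous (s + q) := hc ▸ u.2
    obtain ⟨a, b, ha, hb, hab⟩ := exists_isHomogeneous_of_mul hu hne
    obtain rfl := ha.inj_right hH hH0
    obtain rfl : b = q := by omega
    exact hb
  exact ⟨⟨c, hcq⟩, Prod.ext (Subtype.ext hc.symm) (Subtype.ext hw.symm)⟩

/-- The inequality of Bezout's theorem with multiplicities, for two forms without a common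
factor. -/
lemma sum_mul_le_of_isRelPrime {F H : MvPolynomial (Fin 3) K} {r s : ℕ} (hF : F.IsHomogeneous r)
    (hH : H.IsHomogeneous s) (hH0 : H ≠ 0) (hrel : IsRelPrime F H)
    (Z : Finset (ℙ K (Fin 3 → K))) (a b : ℙ K (Fin 3 → K) → ℕ)
    (ha : ∀ P ∈ Z, F ∈ pointIdeal P ^ a P) (hb : ∀ P ∈ Z, H ∈ pointIdeal P ^ b P) :
    ∑ P ∈ Z, a P * b P ≤ r * s := by
  -- The degree is raised by `q` so that the jets of orders `a P + b P` impose independent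
  -- conditions.
  set q := ∑ P ∈ Z, (a P + b P)
  set T : Forms K (s + q) × Forms K (r + q) →ₗ[K] Forms K (r + (s + q)) :=
    (mulForm hF rfl).coprod (mulForm hH (by ring)) with hT
  set J := multijet Z (r + (s + q)) (fun P ↦ a P + b P)
  have hJ : Function.Surjective J := multijet_surjective Z (by omega)
  have h1 : finrank K (LinearMap.ker T) ≤ finrank K (Forms K q) :=
    finrank_ker_syzygy_le hF hH hH0 hrel q
  have h2 := T.finrank_range_add_finrank_ker
  have h3 := J.finrank_range_add_finrank_ker
  rw [LinearMap.range_eq_top.2 hJ, finrank_top] at h3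
  have h4 : finrank K (LinearMap.range T) ≤
      finrank K (LinearMap.range (J ∘ₗ T)) + finrank K (LinearMap.ker J) :=
    finrank_range_le_add_finrank_ker T J
  -- Modulo order `a + b`, `F u + H w` depends only on `u` modulo order `b` and on `w` modulo order
  -- `a`.
  have h7 : finrank K (LinearMap.range (J ∘ₗ T)) ≤
      finrank K (Π P : Z, JetIndex (b P) → K) + finrank K (Π P : Z, JetIndex (a P) → K) := by
    rw [← finrank_prod]
    refine (finrank_range_le_of_ker_le (g := (multijet Z (s + q) b).prodMap
      (multijet Z (r + q) a)) ?_).trans (Submodule.finrank_le _)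
    rintro ⟨u, w⟩ huw
    have hu := multijet_eq_zero_iff.1 (congrArg Prod.fst huw)
    have hw := multijet_eq_zero_iff.1 (congrArg Prod.snd huw)
    rw [LinearMap.mem_ker, LinearMap.comp_apply, multijet_eq_zero_iff]
    intro P hP
    change F * u.1 + H * w.1 ∈ _
    refine add_mem ?_ ?_
    · rw [pow_add]; exact Ideal.mul_mem_mul (ha P hP) (hu P hP)
    · rw [add_comm, pow_add]; exact Ideal.mul_mem_mul (hb P hP) (hw P hP)
  rw [finrank_prod] at h2
  have d1 := two_mul_finrank_forms (K := K) q
  have d2 := two_mul_finrank_forms (K := K) (s + q)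
  have d3 := two_mul_finrank_forms (K := K) (r + q)
  have d4 := two_mul_finrank_forms (K := K) (r + (s + q))
  have e1 := two_mul_finrank_multijet Z a
  have e2 := two_mul_finrank_multijet Z b
  have e3 := two_mul_finrank_multijet Z fun P ↦ a P + b P
  have e4 : ∑ P ∈ Z, (a P + b P) * (a P + b P + 1) = ∑ P ∈ Z, a P * (a P + 1) +
      ∑ P ∈ Z, b P * (b P + 1) + 2 * ∑ P ∈ Z, a P * b P := by
    rw [Finset.mul_sum, ← Finset.sum_add_distrib, ← Finset.sum_add_distrib]
    exact Finset.sum_congr rfl fun P _ ↦ by ring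
  -- The form dimensions combine to `-r s` and the jet dimensions to `-∑ a b`.
  nlinarith

end Multijet

end

section

variable {K : Type*} [Field K]

/-! ### Forms of minimal degree -/

/-- Subtracting the hypotheses gives `∑ b ≤ t + 1`. If every `b` were at most `t`, then `∑ b (b + 1)
≤ (t + 1) ^ 2`, which is too small; so one term uses up the whole sum. -/
lemma exists_eq_and_forall_eq_zero {ι : Type*} (Z : Finset ι) (b : ι → ℕ) (t : ℕ)
    (h1 : ∑ P ∈ Z, b P * (b P + 1) = (t + 1) * (t + 2))
    (h2 : t * (t + 1) ≤ ∑ P ∈ Z, (b P - 1) * b P) :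
    ∃ P ∈ Z, b P = t + 1 ∧ ∀ Q ∈ Z, Q ≠ P → b Q = 0 := by
  classical
  have h3 : ∑ P ∈ Z, b P * (b P + 1) = ∑ P ∈ Z, (b P - 1) * b P + 2 * ∑ P ∈ Z, b P := by
    rw [Finset.mul_sum, ← Finset.sum_add_distrib]
    refine Finset.sum_congr rfl fun P _ ↦ ?_
    rcases b P with _ | n
    · rfl
    · simp only [Nat.add_sub_cancel]; ring
  have h4 : ∑ P ∈ Z, b P ≤ t + 1 := by nlinarith
  obtain ⟨P, hP, hbP⟩ : ∃ P ∈ Z, t + 1 ≤ b P := by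
    by_contra! h
    have h5 : ∑ P ∈ Z, b P * (b P + 1) ≤ ∑ P ∈ Z, b P * (t + 1) :=
      Finset.sum_le_sum fun P hP ↦ Nat.mul_le_mul_left _ (h P hP)
    rw [← Finset.sum_mul] at h5
    nlinarith
  have h6 := Finset.add_sum_erase Z b hP
  refine ⟨P, hP, by omega, fun Q hQ hQP ↦ ?_⟩
  have h7 := Finset.single_le_sum (f := b) (fun _ _ ↦ Nat.zero_le _)
    (Finset.mem_erase.2 ⟨hQP, hQ⟩)
  omega

lemma exists_isHomogeneous_factors {F G : MvPolynomial (Fin 3) K} {d d' : ℕ}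
    (hF : F.IsHomogeneous d) (hF0 : F ≠ 0) (hG : G.IsHomogeneous d') (hG0 : G ≠ 0) :
    ∃ (A B C : MvPolynomial (Fin 3) K) (r s e : ℕ), A.IsHomogeneous r ∧ B.IsHomogeneous s ∧
      C.IsHomogeneous e ∧ IsRelPrime A B ∧ C * A = F ∧ C * B = G ∧ e + r = d ∧ e + s = d' := by
  obtain ⟨A, B, C, hrel, rfl, rfl⟩ := UniqueFactorizationMonoid.exists_reduced_factors F hF0 G
  obtain ⟨e, r, he, hr, her⟩ := exists_isHomogeneous_of_mul hF hF0
  obtain ⟨e', s, he', hs, hes⟩ := exists_isHomogeneous_of_mul hG hG0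
  obtain rfl := he.inj_right he' (left_ne_zero_of_mul hF0)
  exact ⟨A, B, C, r, s, e, hr, hs, he, hrel, rfl, rfl, her, hes⟩

variable [CharZero K]

lemma exists_order (P : ℙ K (Fin 3 → K)) {f : MvPolynomial (Fin 3) K} {n : ℕ}
    (hf : f.IsHomogeneous n) (h0 : f ≠ 0) :
    ∃ g, f ∈ pointIdeal P ^ g ∧ f ∉ pointIdeal P ^ (g + 1) := by
  classical
  have h : ∃ g, f ∉ pointIdeal P ^ (g + 1) :=
    ⟨n, fun h ↦ h0 (eq_zero_of_mem_pow hf h n.lt_succ_self)⟩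
  refine ⟨Nat.find h, ?_, Nat.find_spec h⟩
  rcases hg : Nat.find h with _ | g
  · simp
  · by_contra hfg
    exact Nat.find_min h (m := g) (by omega) hfg

lemma dirDeriv_rep_eq_zero {P : ℙ K (Fin 3 → K)} {f : MvPolynomial (Fin 3) K} {d k : ℕ}
    (hf : f.IsHomogeneous d) (hfk : f ∈ pointIdeal P ^ k) (hk : 0 < k) (hd : d ≤ k) :
    dirDeriv P.rep f = 0 :=
  eq_zero_of_mem_pow (dirDeriv_isHomogeneous hf _) (dirDeriv_rep_mem_pow hfk) (by omega)

/-- If a form `F` of degree `d` with multiplicities at least `k` is not divisible by one of its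
non-zero derivatives, and the initial degree drops by one with each of the two previous
multiplicities, then `d ≤ k`. -/
lemma degree_le_of_not_dirDeriv_dvd {Z : Finset (ℙ K (Fin 3 → K))} {k d : ℕ}
    {F : MvPolynomial (Fin 3) K} (hF : F.IsHomogeneous d) (hF0 : F ≠ 0)
    (hFk : ∀ P ∈ Z, F ∈ pointIdeal P ^ k)
    (hmin₁ : ∀ (n : ℕ) (f : MvPolynomial (Fin 3) K), f.IsHomogeneous n → f ≠ 0 →
      (∀ P ∈ Z, f ∈ pointIdeal P ^ (k - 1)) → d ≤ n + 1)
    (hmin₂ : ∀ (n : ℕ) (f : MvPolynomial (Fin 3) K), f.IsHomogeneous n → f ≠ 0 →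
      (∀ P ∈ Z, f ∈ pointIdeal P ^ (k - 2)) → d ≤ n + 2)
    (hk : 3 ≤ k) (hd : 0 < d) {v : Fin 3 → K} (hv0 : dirDeriv v F ≠ 0)
    (hv : ¬ dirDeriv v F ∣ F) : d ≤ k := by
  have hinf : Infinite K := Infinite.of_injective _ (Nat.cast_injective (R := K))
  obtain ⟨R, H, G, r, s, e, hR, hH, hG, hrel, hGR, hGH, her, hes⟩ :=
    exists_isHomogeneous_factors hF hF0 (dirDeriv_isHomogeneous hF v) hv0
  have hG0 : G ≠ 0 := left_ne_zero_of_mul (hGR ▸ hF0)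
  have hH0 : H ≠ 0 := right_ne_zero_of_mul (hGH ▸ hv0)
  -- a constant cofactor `H` would make the derivative a divisor of `F`
  have hs : s ≠ 0 := by
    rintro rfl
    obtain ⟨c, rfl⟩ : ∃ c, H = C c := ⟨_, totalDegree_eq_zero_iff_eq_C.1
      ((totalDegree_zero_iff_isHomogeneous _).2 hH)⟩
    have hc : c ≠ 0 := by rintro rfl; simp at hH0
    apply hv
    rw [← hGH, ← hGR]
    refine mul_dvd_mul_left _ ((IsUnit.map C (Ne.isUnit hc)).dvd)
  obtain ⟨t, rfl⟩ : ∃ t, s = t + 1 := ⟨s - 1, by omega⟩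
  obtain rfl : r = t + 2 := by omega
  choose g hg hg' using fun P : ℙ K (Fin 3 → K) ↦ exists_order P hG hG0
  have hRa (P) (hP : P ∈ Z) : R ∈ pointIdeal P ^ (k - g P) :=
    mem_pow_of_mul_mem (hGR ▸ hFk P hP) (hg' P)
  have hHb (P) (hP : P ∈ Z) : H ∈ pointIdeal P ^ (k - 1 - g P) := by
    refine mem_pow_of_mul_mem ?_ (hg' P)
    rw [hGH]
    refine derivation_mem_pow _ _ _ ?_
    rw [Nat.sub_add_cancel (by omega)]
    exact hFk P hP
  have hbez := sum_mul_le_of_isRelPrime hR hH hH0 hrel Z _ _ hRa hHb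
  -- A form of degree `t` with these multiplicities, times `G`, would have degree `d - 2` and
  -- multiplicities `k - 1`.
  have hcount₁ : (t + 1) * (t + 2) ≤ ∑ P ∈ Z, (k - 1 - g P) * (k - 1 - g P + 1) := by
    refine le_sum_of_forall_eq_zero fun f hf hfZ ↦ ?_
    by_contra hf0
    have := hmin₁ _ _ (hG.mul hf) (mul_ne_zero hG0 hf0) fun P hP ↦
      Ideal.pow_le_pow_right (by omega) (pow_add (pointIdeal P) _ _ ▸
        Ideal.mul_mem_mul (hg P) (hfZ P hP))
    omega
  -- The same with degree `t - 1` and multiplicities `k - 2`; for `t = 0` there is no such degree,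
  -- but the bound is trivial.
  have hcount₂ : t * (t + 1) ≤ ∑ P ∈ Z, (k - 1 - g P - 1) * (k - 1 - g P) := by
    rcases t with _ | t
    · simp
    refine (le_sum_of_forall_eq_zero (m := fun P ↦ k - 1 - g P - 1) fun f hf hfZ ↦ ?_).trans
      (Finset.sum_le_sum fun P _ ↦ ?_)
    · by_contra hf0
      have := hmin₂ _ _ (hG.mul hf) (mul_ne_zero hG0 hf0) fun P hP ↦
        Ideal.pow_le_pow_right (by omega) (pow_add (pointIdeal P) _ _ ▸
          Ideal.mul_mem_mul (hg P) (hfZ P hP))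
      omega
    · rcases k - 1 - g P with _ | n <;> simp
  have hsum : ∑ P ∈ Z, (k - 1 - g P) * (k - 1 - g P + 1) = (t + 1) * (t + 2) := by
    refine le_antisymm (le_trans (Finset.sum_le_sum fun P _ ↦ ?_) (hbez.trans_eq (mul_comm _ _)))
      hcount₁
    -- The identity `k - g P = b_P + 1` can fail through truncation only when `b_P = 0`, and then
    -- both products vanish.
    rcases Nat.eq_zero_or_pos (k - 1 - g P) with h | h
    · simp [h]
    · rw [mul_comm, show k - 1 - g P + 1 = k - g P by omega]
  obtain ⟨P, hP, hbP, hbQ⟩ := exists_eq_and_forall_eq_zero Z _ t hsum hcount₂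
  by_cases hGP : dirDeriv P.rep G = 0
  · have h1 := mem_pow_of_dirDeriv_rep_eq_zero hG hGP
    have h2 : e ≤ g P := by
      by_contra! h
      exact hg' P (Ideal.pow_le_pow_right h h1)
    omega
  · obtain ⟨L, hL, hLP, hL0⟩ := exists_linearForm_mem_pointIdeal P
    -- Needed so that differentiating `G` really lowers the degree, `e - 1` being truncated.
    have he : e ≠ 0 := by
      rintro rfl
      refine hGP ?_
      rw [totalDegree_eq_zero_iff_eq_C.1 ((totalDegree_zero_iff_isHomogeneous _).2 hG)]
      exact (dirDeriv P.rep).map_algebraMap _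
    -- `∂_P G * L ^ t` has degree `d - 3`. Its order is at least `g P + t = k - 2` at `P`, and at
    -- least `k - 2` at the other points, where `G` has order at least `k - 1`. This contradicts
    -- minimality.
    have := hmin₂ _ _ ((dirDeriv_isHomogeneous hG P.rep).mul (hL.pow t))
      (mul_ne_zero hGP (pow_ne_zero _ hL0)) fun Q hQ ↦ ?_
    · omega
    · by_cases hQP : Q = P
      · subst hQP
        refine Ideal.pow_le_pow_right ?_ (pow_add (pointIdeal Q) (g Q) t ▸
          Ideal.mul_mem_mul (dirDeriv_rep_mem_pow (hg Q)) (Ideal.pow_mem_pow hLP t))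
        omega
      · refine Ideal.mul_mem_right _ _ (derivation_mem_pow _ _ _
          (Ideal.pow_le_pow_right ?_ (hg Q)))
        have := hbQ Q hQ hQP
        omega

/-! ### The vertex of a form and collinearity -/

/-- The directions in which the derivative of `F` vanishes. -/
def vertex (F : MvPolynomial (Fin 3) K) : Submodule K (Fin 3 → K) where
  carrier := {v | dirDeriv v F = 0}
  add_mem' {v w} hv hw := by
    change dirDeriv (v + w) F = 0
    rw [dirDeriv_add, show dirDeriv v F = 0 from hv, show dirDeriv w F = 0 from hw, add_zero]
  zero_mem' := by simp [dirDeriv_apply]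
  smul_mem' c v hv := by
    change dirDeriv (c • v) F = 0
    rw [dirDeriv_smul, show dirDeriv v F = 0 from hv, smul_zero]

omit [CharZero K] in
lemma mem_vertex {F : MvPolynomial (Fin 3) K} {v : Fin 3 → K} :
    v ∈ vertex F ↔ dirDeriv v F = 0 := Iff.rfl

/-- If all non-zero derivatives of `F` divide `F`, then any two directions have a common
combination along which the derivative of `F` vanishes. -/
lemma exists_smul_sub_mem_vertex {F : MvPolynomial (Fin 3) K} (hF0 : F ≠ 0)
    (h : ∀ v, dirDeriv v F ≠ 0 → dirDeriv v F ∣ F) {v w : Fin 3 → K} (hw : w ∉ vertex F) :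
    ∃ c : K, v - c • w ∈ vertex F := by
  have hinf : Infinite K := Infinite.of_injective _ (Nat.cast_injective (R := K))
  by_cases hv : ∃ c : K, dirDeriv (v - c • w) F = 0
  · exact hv
  push Not at hv
  have hfin := @Finite.of_fintype _ (UniqueFactorizationMonoid.fintypeSubtypeDvd
    (Associates.mk F) (Associates.mk_ne_zero.2 hF0))
  -- Pigeonhole: two members of the infinite pencil are associated divisors of `F`, hence
  -- proportional since units are constants. This gives a linear relation modulo the vertex.
  obtain ⟨s, t, hst, heq⟩ := Finite.exists_ne_map_eq_of_infinite
    fun c : K ↦ (⟨Associates.mk (dirDeriv (v - c • w) F),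
      Associates.mk_dvd_mk.2 (h _ (hv c))⟩ :
        {x : Associates (MvPolynomial (Fin 3) K) // x ∣ Associates.mk F})
  obtain ⟨u, hu⟩ := Associates.mk_eq_mk_iff_associated.1 (congrArg Subtype.val heq)
  obtain ⟨a, ha, hau⟩ := MvPolynomial.isUnit_iff_eq_C_of_isReduced.1 u.isUnit
  rw [hau, mul_comm, ← smul_eq_C_mul, ← dirDeriv_smul] at hu
  have h1 : a • (v - s • w) - (v - t • w) ∈ vertex F := by
    rw [mem_vertex, sub_eq_add_neg, dirDeriv_add, hu, ← neg_one_smul K, dirDeriv_smul]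
    simp
  have h2 : a • (v - s • w) - (v - t • w) = (a - 1) • v - (a * s - t) • w := by module
  rw [h2] at h1
  by_cases ha1 : a = 1
  · subst ha1
    rw [sub_self, zero_smul, zero_sub, Submodule.neg_mem_iff, one_mul,
      Submodule.smul_mem_iff _ (sub_ne_zero.2 hst)] at h1
    exact absurd h1 hw
  · refine ⟨(a - 1)⁻¹ * (a * s - t), ?_⟩
    have h3 := Submodule.smul_mem _ (a - 1)⁻¹ h1
    rwa [smul_sub, smul_smul, smul_smul, inv_mul_cancel₀ (sub_ne_zero.2 ha1), one_smul] at h3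

lemma rep_mem_vertex {Z : Finset (ℙ K (Fin 3 → K))} {k d : ℕ}
    {F : MvPolynomial (Fin 3) K} (hF : F.IsHomogeneous d) (hF0 : F ≠ 0)
    (hFk : ∀ P ∈ Z, F ∈ pointIdeal P ^ k)
    (hmin₁ : ∀ (n : ℕ) (f : MvPolynomial (Fin 3) K), f.IsHomogeneous n → f ≠ 0 →
      (∀ P ∈ Z, f ∈ pointIdeal P ^ (k - 1)) → d ≤ n + 1)
    (hmin₂ : ∀ (n : ℕ) (f : MvPolynomial (Fin 3) K), f.IsHomogeneous n → f ≠ 0 →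
      (∀ P ∈ Z, f ∈ pointIdeal P ^ (k - 2)) → d ≤ n + 2)
    (hk : 3 ≤ k) (hd : 0 < d) {P : ℙ K (Fin 3 → K)} (hP : P ∈ Z) : P.rep ∈ vertex F := by
  by_cases h : ∀ v, dirDeriv v F ≠ 0 → dirDeriv v F ∣ F
  · by_contra hPF
    refine hF0 (eq_zero_of_dirDeriv_eq_zero hF (N := vertex F) (fun v hv ↦ hv) (p := P.rep)
      (eval_eq_zero_of_mem_pointIdeal (Ideal.pow_le_self (by omega) (hFk P hP))
        (rep_mem_submodule P)) ?_)
    refine eq_top_iff.2 fun v _ ↦ ?_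
    obtain ⟨c, hc⟩ := exists_smul_sub_mem_vertex hF0 h (v := v) hPF
    exact Submodule.mem_sup.2 ⟨_, hc, c • P.rep,
      Submodule.smul_mem _ _ (Submodule.mem_span_singleton_self _), by abel⟩
  · push Not at h
    obtain ⟨v, hv0, hv⟩ := h
    exact dirDeriv_rep_eq_zero hF (hFk P hP) (by omega)
      (degree_le_of_not_dirDeriv_dvd hF hF0 hFk hmin₁ hmin₂ hk hd hv0 hv)

omit [CharZero K] in
lemma mem_symbolicPower {Z : Finset (ℙ K (Fin 3 → K))} {m : ℕ} {f : MvPolynomial (Fin 3) K} :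
    f ∈ symbolicPower Z m ↔ ∀ P ∈ Z, f ∈ pointIdeal P ^ m := by
  simp [symbolicPower, Submodule.mem_iInf]

omit [CharZero K] in
lemma isCollinear_of_forall_rep_mem {Z : Set (ℙ K (Fin 3 → K))} {N : Submodule K (Fin 3 → K)}
    (hN : N ≠ ⊤) (h : ∀ P ∈ Z, P.rep ∈ N) : Projectivization.IsCollinear Z := by
  refine ⟨N.projectivization, ?_, ?_, fun P hP ↦ ?_⟩
  · rw [Projectivization.Subspace.submodule.apply_symm_apply]
    infer_instance
  · rw [Projectivization.Subspace.submodule.apply_symm_apply]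
    have := Submodule.finrank_lt hN
    rw [finrank_fin_fun] at this
    omega
  · refine (Submodule.mem_projectivization_iff_submodule_le N P).2 ?_
    rw [P.submodule_eq, Submodule.span_singleton_le_iff_mem]
    exact h P hP

end

end PlanarPoints

end

theorem mainTheorem3 {K : Type*} [Field K] [IsAlgClosed K] [CharZero K]
    (Z : Finset (ℙ K (Fin 3 → K))) (k : ℕ) (hk : 3 ≤ k)
    (h₁ : PlanarPoints.alphaDiff Z k (k - 1) = 1)
    (h₂ : PlanarPoints.alphaDiff Z (k - 1) (k - 2) = 1) :
    Projectivization.IsCollinear (Z : Set (ℙ K (Fin 3 → K))) := by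
  open PlanarPoints in
  unfold alphaDiff at h₁ h₂
  -- By `h₁` the initial degree is positive, so it is not the default value of `sInf ∅` and is
  -- attained.
  obtain ⟨F, hFZ, hF, hF0⟩ := Nat.sInf_mem (Nat.nonempty_of_pos_sInf
    (show 0 < initialDegree (symbolicPower Z k) by omega))
  change F.IsHomogeneous (initialDegree (symbolicPower Z k)) at hF
  rw [mem_symbolicPower] at hFZ
  have hmin (m n : ℕ) (f : MvPolynomial (Fin 3) K) (hf : f.IsHomogeneous n) (hf0 : f ≠ 0)
      (hfm : ∀ P ∈ Z, f ∈ pointIdeal P ^ m) : initialDegree (symbolicPower Z m) ≤ n :=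
    Nat.sInf_le ⟨f, mem_symbolicPower.2 hfm, hf, hf0⟩
  refine isCollinear_of_forall_rep_mem (N := vertex F) (fun h ↦ ?_) fun P hP ↦
    rep_mem_vertex hF hF0 hFZ (fun n f hf hf0 hfm ↦ ?_) (fun n f hf hf0 hfm ↦ ?_) hk (by omega) hP
  · exact hF0 (eq_zero_of_forall_dirDeriv hF (by omega) fun v ↦
      mem_vertex.1 (h ▸ Submodule.mem_top))
  · have := hmin _ n f hf hf0 hfm
    omega
  · have := hmin _ n f hf hf0 hfm
    omega
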